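/- Let $k$ be an algebraically closed field, $n\ge 0$, $S=k[x_0,\dots,x_n]$, and let $i\colon C\hookrightarrow\mathbb{P}^n_k=\operatorname{Proj} S$ be a reduced closed subscheme with ideal sheaf $\mathcal{I}$. Let $\mathcal{J}\subset\mathcal{I}$ be the kernel of the $\mathcal O_{\mathbb P^n}$-linear map $\mathcal{I}\to\Omega_{\mathbb{P}^n/k}/\mathcal{I}\,\Omega_{\mathbb{P}^n/k}$ induced by $f\mapsto df$; equivalently, $\mathcal J$ is defined by the exact sequence $$0\to\mathcal{J}\to\mathcal{I}\to\Omega_{\mathbb{P}^n/k}/\mathcal{I}\,\Omega_{\mathbb{P}^n/k}\to i_*\Omega_{C/k}\to 0 .$$ Put $\widetilde\Gamma(\mathcal{J})=\bigoplus_{l\in\mathbb{Z}}\Gamma(\mathbb{P}^n,\mathcal{J}(l))$, where $\mathcal{J}(l)\subset\mathcal{O}_{\mathbb{P}^n}(l)$. For a nonzero homogeneous $F\in S_l$, regarded as a section of $\mathcal O_{\mathbb P^n}(l)$, let $V(F)=\operatorname{Proj}(S/FS)\subset\mathbb{P}^n$, and let $V(F)_{\mathrm{sing}}$ be the set of points of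 $V(F)$ at which the local ring of $V(F)$ is not regular. (1) For every nonzero homogeneous $F\in S$ of degree $l$, every point of $C$ lies in $V(F)_{\mathrm{sing}}$ if and only if $F\in\widetilde\Gamma(\mathcal{J})$, that is, $F\in\Gamma(\mathbb{P}^n,\mathcal{J}(l))$. (2) (Affine core.) Let $A=k[x_1,\dots,x_n]$, let $I\subset A$ be a radical ideal, and let $f\in A$. Then $f\in I$ and $df\in I\,\Omega_{A/k}$ if and only if $f\in\mathfrak{m}^2$ for every maximal ideal $\mathfrak{m}\supset I$. In particular, for $f\in I$, one has $df\in I\,\Omega_{A/k}$ if and only if $f\in\mathfrak m^2$ for every maximal ideal $\mathfrak m\supset I$. -/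

import Mathlib

open CategoryTheory AlgebraicGeometry TopologicalSpace

universe u

noncomputable section

namespace SingularAlong

/-! ### The kernel of `I → Ω_A / I Ω_A` -/

section Affine

variable (R : Type*) {A : Type*} [CommRing R] [CommRing A] [Algebra R A]

/-- The `A`-linear map `I → Ω_{A/R} / I Ω_{A/R}`, `f ↦ df mod I Ω_{A/R}`, for an ideal `I` of `A`. -/
def conormalMap (I : Ideal A) :
    I →ₗ[A] Ω[A⁄R] ⧸ (I • (⊤ : Submodule A (Ω[A⁄R]))) where
  toFun f := Submodule.Quotient.mk (KaehlerDifferential.D R A f)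
  map_add' f g := by simp
  map_smul' a f := by
    have h : (f : A) • KaehlerDifferential.D R A a ∈ I • (⊤ : Submodule A (Ω[A⁄R])) :=
      Submodule.smul_mem_smul f.2 trivial
    simpa [Derivation.leibniz] using (Submodule.Quotient.mk_eq_zero _).2 h

/-- The kernel of `I → Ω_{A/R} / I Ω_{A/R}`, as an ideal of `A`. -/
def conormalKernel (I : Ideal A) : Ideal A :=
  (LinearMap.ker (conormalMap R I)).map I.subtype

theorem mem_conormalKernel {I : Ideal A} {f : A} :
    f ∈ conormalKernel R I ↔
      f ∈ I ∧ KaehlerDifferential.D R A f ∈ I • (⊤ : Submodule A (Ω[A⁄R])) := by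
  constructor
  · rintro ⟨⟨g, hg⟩, h, rfl⟩
    exact ⟨hg, (Submodule.Quotient.mk_eq_zero _).1 h⟩
  · rintro ⟨hf, h⟩
    exact ⟨⟨f, hf⟩, (Submodule.Quotient.mk_eq_zero _).2 h, rfl⟩

/-- The kernel of `I → Ω / I Ω` commutes with localization at an element. -/
theorem conormalKernel_map {B : Type*} [CommRing B] [Algebra A B] [Algebra R B]
    [IsScalarTower R A B] (f : A) [IsLocalization.Away f B] (I : Ideal A) :
    (conormalKernel R I).map (algebraMap A B) =
      conormalKernel R (I.map (algebraMap A B)) := by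
  have hI : ∀ w ∈ I • (⊤ : Submodule A (Ω[A⁄R])), KaehlerDifferential.map R R A B w ∈
      I.map (algebraMap A B) • (⊤ : Submodule B (Ω[B⁄R])) := by
    intro w hw
    induction hw using Submodule.smul_induction_on' with
    | smul r hr n _ =>
      rw [map_smul, ← IsScalarTower.algebraMap_smul B r]
      exact Submodule.smul_mem_smul (Ideal.mem_map_of_mem _ hr) trivial
    | add x _ y _ hx hy => rw [map_add]; exact add_mem hx hy
  have hloc := KaehlerDifferential.isLocalizedModule_map R A B (Submonoid.powers f)
  have hback : ∀ z ∈ I.map (algebraMap A B) • (⊤ : Submodule B (Ω[B⁄R])),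
      ∃ s ∈ Submonoid.powers f, ∃ w ∈ I • (⊤ : Submodule A (Ω[A⁄R])),
        s • z = KaehlerDifferential.map R R A B w := by
    intro z hz
    induction hz using Submodule.smul_induction_on' with
    | smul r hr n _ =>
      obtain ⟨⟨a, s⟩, has⟩ := (IsLocalization.mem_map_algebraMap_iff (Submonoid.powers f) B).1 hr
      obtain ⟨⟨w, t⟩, hw⟩ := IsLocalizedModule.surj (Submonoid.powers f)
        (KaehlerDifferential.map R R A B) n
      refine ⟨s * t, mul_mem s.2 t.2, (a : A) • w, Submodule.smul_mem_smul a.2 trivial, ?_⟩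
      rw [map_smul, ← hw]
      change ((s : A) * t) • r • n = (a : A) • (t : A) • n
      rw [← IsScalarTower.algebraMap_smul B (a : A), ← has, mul_smul,
        smul_comm (t : A) r n, ← IsScalarTower.algebraMap_smul B (s : A), smul_smul, mul_comm]
    | add x _ y _ hx hy =>
      obtain ⟨s, hs, w, hw, h1⟩ := hx
      obtain ⟨t, ht, v, hv, h2⟩ := hy
      refine ⟨s * t, mul_mem hs ht, t • w + s • v,
        add_mem (Submodule.smul_mem _ _ hw) (Submodule.smul_mem _ _ hv), ?_⟩
      rw [map_add, map_smul, map_smul, ← h1, ← h2, smul_add, smul_smul, smul_smul, mul_comm t s]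
  apply le_antisymm
  · rw [Ideal.map_le_iff_le_comap]
    intro g hg
    rw [mem_conormalKernel] at hg
    rw [Ideal.mem_comap, mem_conormalKernel]
    refine ⟨Ideal.mem_map_of_mem _ hg.1, ?_⟩
    have := hI _ hg.2
    rwa [KaehlerDifferential.map_D] at this
  · intro g hg
    rw [mem_conormalKernel] at hg
    obtain ⟨⟨a, s⟩, has⟩ := (IsLocalization.mem_map_algebraMap_iff (Submonoid.powers f) B).1 hg.1
    -- `algebraMap a = s g` has differential in `I_f Ω`
    have ha : KaehlerDifferential.D R B (algebraMap A B a) ∈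
        I.map (algebraMap A B) • (⊤ : Submodule B (Ω[B⁄R])) := by
      rw [← has, Derivation.leibniz]
      exact add_mem (Submodule.smul_mem_smul hg.1 trivial) (Submodule.smul_mem _ _ hg.2)
    obtain ⟨t, ht, w, hw, h⟩ := hback _ ha
    rw [← KaehlerDifferential.map_D R R A B, ← map_smul] at h
    obtain ⟨c, hc⟩ := (IsLocalizedModule.eq_iff_exists (Submonoid.powers f)
      (KaehlerDifferential.map R R A B)).1 h
    have hc' : ((c : A) * t) • KaehlerDifferential.D R A (a : A) ∈
        I • (⊤ : Submodule A (Ω[A⁄R])) := by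
      rw [mul_smul]
      change (c : A) • t • KaehlerDifferential.D R A (a : A) = (c : A) • w at hc
      rw [hc]
      exact Submodule.smul_mem _ _ hw
    rw [IsLocalization.mem_map_algebraMap_iff (Submonoid.powers f) B]
    refine ⟨⟨⟨(c * t) * a, ?_⟩, ⟨s * (c * t), mul_mem s.2 (mul_mem c.2 ht)⟩⟩, ?_⟩
    · rw [mem_conormalKernel, Derivation.leibniz]
      exact ⟨Ideal.mul_mem_left _ _ a.2, add_mem hc' (Submodule.smul_mem_smul a.2 trivial)⟩
    · simp only [map_mul] at has ⊢
      rw [← has]; ring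

end Affine

/-! ### The ideal sheaf `𝒥`, the kernel of `ℐ → Ω_X / ℐ Ω_X` -/

section Sheaf

variable {R : Type u} [CommRing R] {X : Scheme.{u}}

/-- The ring map `R → Γ(X, U)` of an `R`-scheme `p : X ⟶ Spec R`. -/
def structureRingHom (p : X ⟶ Spec (.of R)) (U : X.Opens) : R →+* Γ(X, U) :=
  ((Scheme.ΓSpecIso (.of R)).inv ≫ p.appLE ⊤ U le_top).hom

/-- For an `R`-scheme `p : X ⟶ Spec R` and a quasi-coherent ideal sheaf `ℐ`, the ideal sheaf
`𝒥 = ker (ℐ → Ω_{X/R} / ℐ Ω_{X/R})`. The sheaf `Ω_{X/R}` is the quasi-coherent sheaf whose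
sections on an affine open `U` are the Kähler differentials of `Γ(X, U)` over `R`, so that
`𝒥(U) = ker (ℐ(U) → Ω_{Γ(X, U)/R} / ℐ(U) Ω_{Γ(X, U)/R})`. -/
def conormalKernelSheaf (p : X ⟶ Spec (.of R)) (I : X.IdealSheafData) : X.IdealSheafData where
  ideal U :=
    letI : Algebra R Γ(X, U) := (structureRingHom p U).toAlgebra
    conormalKernel R (I.ideal U)
  map_ideal_basicOpen U f := by
    let _ : Algebra R Γ(X, U) := (structureRingHom p U).toAlgebra
    let _ : Algebra R Γ(X, X.basicOpen f) := (structureRingHom p (X.basicOpen f)).toAlgebra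
    have : IsScalarTower R Γ(X, U) Γ(X, X.basicOpen f) := by
      refine IsScalarTower.of_algebraMap_eq' ?_
      change structureRingHom p (X.basicOpen f) =
        (X.presheaf.map (homOfLE (X.basicOpen_le f)).op).hom.comp (structureRingHom p U)
      have h := p.appLE_map (U := ⊤) (V := U) (V' := X.basicOpen f) (show (U : X.Opens) ≤ _ from le_top)
        (homOfLE (X.basicOpen_le f)).op
      exact congr(((Scheme.ΓSpecIso (.of R)).inv ≫ $h).hom).symm
    have inst := U.2.isLocalization_basicOpen f
    have h := conormalKernel_map R (B := Γ(X, X.basicOpen f)) f (I.ideal U)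
    have h2 : (I.ideal U).map (algebraMap Γ(X, U) Γ(X, X.basicOpen f)) =
      I.ideal (X.affineBasicOpen f) := I.map_ideal_basicOpen U f
    rw [h2] at h
    exact h

/-- The set of singular points of a (locally Noetherian) scheme: the points whose local ring is
not regular. -/
def singularLocus (X : Scheme.{u}) : Set X :=
  {x | ¬ IsRegularLocalRing (X.presheaf.stalk x)}

end Sheaf

/-! ### Twisting sheaves on `Proj` -/

section Twist

variable {σ : Type*} {A : Type u} [CommRing A] [SetLike σ A] [AddSubgroupClass σ A]
  (𝒜 : ℕ → σ) [GradedRing 𝒜]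

/-- The homogeneous prime ideal of `A` that is the point `x` of `Proj 𝒜`. -/
abbrev pointIdeal (x : Proj 𝒜) : Ideal A :=
  HomogeneousIdeal.toIdeal (ProjectiveSpectrum.asHomogeneousIdeal x)

instance (x : Proj 𝒜) : (pointIdeal 𝒜 x).IsPrime := ProjectiveSpectrum.isPrime x

/-- Functions on an open subset `U` of `Proj 𝒜` with value in `A_p` at each `p ∈ U`. -/
abbrev Values (U : (Proj 𝒜).Opens) : Type u :=
  ∀ x : U, Localization.AtPrime (pointIdeal 𝒜 (x : Proj 𝒜))

variable {𝒜}

/-- Restriction of functions. -/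
def Values.restrict {U V : (Proj 𝒜).Opens} (h : V ≤ U) (t : Values 𝒜 U) : Values 𝒜 V :=
  fun x ↦ t ⟨x, h x.2⟩

/-- A section of the structure sheaf of `Proj 𝒜` as a function with values in the `A_p`. -/
def ofSection {U : (Proj 𝒜).Opens} (s : Γ(Proj 𝒜, U)) : Values 𝒜 U :=
  fun x ↦ (s.1 x).val

/-- An element of `A` as a function with values in the `A_p`. -/
def ofElement (a : A) (U : (Proj 𝒜).Opens) : Values 𝒜 U :=
  fun _ ↦ algebraMap A _ a

variable (𝒜)

theorem exists_denominator (x : Proj 𝒜) (N : ℕ) :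
    ∃ (j : ℕ) (b : 𝒜 j), N ≤ j ∧ (b : A) ∉ pointIdeal 𝒜 x := by
  have h := ProjectiveSpectrum.not_irrelevant_le x
  rw [← toIdeal_le_toIdeal_iff, HomogeneousIdeal.toIdeal_irrelevant_le] at h
  push Not at h
  obtain ⟨i, hi, h⟩ := h
  obtain ⟨b, hb, hbx⟩ := Set.not_subset.1 h
  refine ⟨N • i, ⟨b ^ N, SetLike.pow_mem_graded N hb⟩, ?_, ?_⟩
  · rw [smul_eq_mul]; exact Nat.le_mul_of_pos_right N hi
  · exact fun hc ↦ hbx (Ideal.IsPrime.mem_of_pow_mem inferInstance N hc)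

/-- The group `Γ(U, 𝒪(l))` of sections over `U` of the twisting sheaf `𝒪(l)` on `Proj 𝒜`, `l ∈ ℤ`,
i.e. of the sheaf attached to the shifted graded module `A(l)`: functions that locally are
fractions `a / b` with `a`, `b` homogeneous, `deg a = deg b + l`. -/
def twistSections (l : ℤ) (U : (Proj 𝒜).Opens) : AddSubgroup (Values 𝒜 U) where
  carrier := {t | ∀ x : U, ∃ V : (Proj 𝒜).Opens, (x : Proj 𝒜) ∈ V ∧
    ∃ (i j : ℕ) (a : 𝒜 i) (b : 𝒜 j), (i : ℤ) = j + l ∧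
      ∀ y : U, (y : Proj 𝒜) ∈ V →
        ∃ hb : (b : A) ∉ pointIdeal 𝒜 (y : Proj 𝒜),
          t y = Localization.mk (a : A) ⟨b, hb⟩}
  zero_mem' x := by
    obtain ⟨j, b, hj, hb⟩ := exists_denominator 𝒜 x l.natAbs
    refine ⟨Proj.basicOpen 𝒜 b, hb, (j + l).toNat, j, 0, b, by omega, fun y hy ↦ ⟨hy, ?_⟩⟩
    simp [Localization.mk_zero]
  add_mem' := by
    intro s t hs ht x
    obtain ⟨V, hV, i, j, a, b, hij, h⟩ := hs x
    obtain ⟨W, hW, i', j', a', b', hij', h'⟩ := ht x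
    refine ⟨V ⊓ W, ⟨hV, hW⟩, j' + i, j' + j,
      ⟨b' * a + b * a', add_mem (SetLike.mul_mem_graded b'.2 a.2) ?_⟩,
      ⟨b' * b, SetLike.mul_mem_graded b'.2 b.2⟩, by push_cast; omega, ?_⟩
    · have : j + i' = j' + i := by omega
      rw [← this]
      exact SetLike.mul_mem_graded b.2 a'.2
    · rintro y ⟨hyV, hyW⟩
      obtain ⟨hb, e⟩ := h y hyV
      obtain ⟨hb', e'⟩ := h' y hyW
      refine ⟨(pointIdeal 𝒜 (y : Proj 𝒜)).primeCompl.mul_mem hb' hb, ?_⟩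
      rw [Pi.add_apply, e, e', Localization.add_mk, Localization.mk_eq_mk_iff,
        Localization.r_iff_exists]
      exact ⟨1, by simp only [Submonoid.coe_mul, OneMemClass.coe_one]; ring⟩
  neg_mem' := by
    intro s hs x
    obtain ⟨V, hV, i, j, a, b, hij, h⟩ := hs x
    refine ⟨V, hV, i, j, ⟨-a, neg_mem a.2⟩, b, hij, fun y hy ↦ ?_⟩
    obtain ⟨hb, e⟩ := h y hy
    exact ⟨hb, by rw [Pi.neg_apply, e, Localization.neg_mk]⟩

variable {𝒜}

theorem restrict_mem_twistSections {l : ℤ} {U V : (Proj 𝒜).Opens} (h : V ≤ U)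
    {t : Values 𝒜 U} (ht : t ∈ twistSections 𝒜 l U) : Values.restrict h t ∈ twistSections 𝒜 l V := by
  intro x
  obtain ⟨W, hW, i, j, a, b, hij, H⟩ := ht ⟨x, h x.2⟩
  exact ⟨W, hW, i, j, a, b, hij, fun y hy ↦ H ⟨y, h y.2⟩ hy⟩

theorem ofElement_mem_twistSections {l : ℕ} {a : A} (ha : a ∈ 𝒜 l) (U : (Proj 𝒜).Opens) :
    ofElement a U ∈ twistSections 𝒜 l U := fun _ ↦
  ⟨⊤, trivial, l, 0, ⟨a, ha⟩, ⟨1, SetLike.one_mem_graded 𝒜⟩, by simp, fun y _ ↦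
    ⟨(pointIdeal 𝒜 (y : Proj 𝒜)).primeCompl.one_mem, (Localization.mk_one_eq_algebraMap a).symm⟩⟩

/-- The group `𝒥(U) · Γ(U, 𝒪(l))` of finite sums of products, on an affine open `U`. -/
def idealMulTwist (J : (Proj 𝒜).IdealSheafData) (l : ℤ) (U : (Proj 𝒜).affineOpens) :
    AddSubgroup (Values 𝒜 (U : (Proj 𝒜).Opens)) :=
  AddSubgroup.closure {t | ∃ s ∈ J.ideal U, ∃ r : Values 𝒜 (U : (Proj 𝒜).Opens),
    r ∈ twistSections 𝒜 l U ∧ t = ofSection s * r}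

theorem restrict_mem_idealMulTwist (J : (Proj 𝒜).IdealSheafData) {l : ℤ}
    {U V : (Proj 𝒜).affineOpens}
    (h : (V : (Proj 𝒜).Opens) ≤ (U : (Proj 𝒜).Opens)) {t : Values 𝒜 (U : (Proj 𝒜).Opens)}
    (ht : t ∈ idealMulTwist J l U) : Values.restrict h t ∈ idealMulTwist J l V := by
  induction ht using AddSubgroup.closure_induction with
  | mem t ht =>
    obtain ⟨s, hs, r, hr, rfl⟩ := ht
    refine AddSubgroup.subset_closure
      ⟨((Proj 𝒜).presheaf.map (homOfLE h).op).hom s, ?_, Values.restrict h r,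
        restrict_mem_twistSections h hr, rfl⟩
    rw [← J.map_ideal h]
    exact Ideal.mem_map_of_mem _ hs
  | zero => exact zero_mem _
  | add x y _ _ hx hy => exact add_mem hx hy
  | neg x _ hx => exact neg_mem hx

/-- The group `Γ(U, 𝒥(l))`, for a quasi-coherent ideal sheaf `𝒥` on `Proj 𝒜`. Here `𝒥(l)` is the
subsheaf `𝒥 · 𝒪(l)` of `𝒪(l)`, the image of `𝒥 ⊗ 𝒪(l) → 𝒪(l)` (which is injective if `𝒪(l)` is
invertible): its sections are the sections of `𝒪(l)` that are locally in `𝒥(V) · Γ(V, 𝒪(l))`. -/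
def idealTwistSections (J : (Proj 𝒜).IdealSheafData) (l : ℤ) (U : (Proj 𝒜).Opens) :
    AddSubgroup (Values 𝒜 U) where
  carrier := {t | t ∈ twistSections 𝒜 l U ∧ ∀ x : U, ∃ (V : (Proj 𝒜).affineOpens)
    (h : (V : (Proj 𝒜).Opens) ≤ U), (x : Proj 𝒜) ∈ (V : (Proj 𝒜).Opens) ∧
      Values.restrict h t ∈ idealMulTwist J l V}
  zero_mem' := by
    refine ⟨zero_mem _, fun x ↦ ?_⟩
    obtain ⟨V, hV, hxV, h⟩ := Opens.isBasis_iff_nbhd.1 (Proj 𝒜).isBasis_affineOpens x.2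
    exact ⟨⟨V, hV⟩, h, hxV, zero_mem _⟩
  add_mem' := by
    rintro s t ⟨hs, hs'⟩ ⟨ht, ht'⟩
    refine ⟨add_mem hs ht, fun x ↦ ?_⟩
    obtain ⟨V, hVU, hxV, hV⟩ := hs' x
    obtain ⟨W, hWU, hxW, hW⟩ := ht' x
    obtain ⟨Y, hY, hxY, hYU⟩ := Opens.isBasis_iff_nbhd.1 (Proj 𝒜).isBasis_affineOpens
      (show (x : Proj 𝒜) ∈ ((V : (Proj 𝒜).Opens) ⊓ W : (Proj 𝒜).Opens) from ⟨hxV, hxW⟩)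
    exact ⟨⟨Y, hY⟩, hYU.trans (inf_le_left.trans hVU), hxY,
      add_mem (restrict_mem_idealMulTwist J (U := V) (V := ⟨Y, hY⟩) (hYU.trans inf_le_left) hV)
        (restrict_mem_idealMulTwist J (U := W) (V := ⟨Y, hY⟩) (hYU.trans inf_le_right) hW)⟩
  neg_mem' := by
    rintro s ⟨hs, hs'⟩
    refine ⟨neg_mem hs, fun x ↦ ?_⟩
    obtain ⟨V, hVU, hxV, hV⟩ := hs' x
    exact ⟨V, hVU, hxV, neg_mem hV⟩

/-- The degree `l` component `Γ(Proj 𝒜, 𝒥(l))` of the graded module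
`Γ̃(𝒥) = ⨁ l, Γ(Proj 𝒜, 𝒥(l))`, for `l ∈ ℤ`. -/
def gammaTilde (J : (Proj 𝒜).IdealSheafData) (l : ℤ) : AddSubgroup (Values 𝒜 ⊤) :=
  idealTwistSections J l ⊤

end Twist

/-! ### The closed subscheme of `Proj` of a homogeneous ideal -/

section Quotient

variable {k : Type u} {A : Type u} [Field k] [CommRing A] [Algebra k A]
  (𝒜 : ℕ → Submodule k A) [GradedAlgebra 𝒜] (I : HomogeneousIdeal 𝒜)

/-- The grading of the quotient of a graded algebra by a homogeneous ideal. -/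
def quotientGrading (i : ℕ) : Submodule k (A ⧸ I.toIdeal) :=
  (𝒜 i).map (Ideal.Quotient.mkₐ k I.toIdeal).toLinearMap

instance : SetLike.GradedMonoid (quotientGrading 𝒜 I) where
  one_mem := ⟨1, SetLike.one_mem_graded 𝒜, rfl⟩
  mul_mem := by
    rintro i j _ _ ⟨a, ha, rfl⟩ ⟨b, hb, rfl⟩
    exact ⟨a * b, SetLike.mul_mem_graded ha hb, rfl⟩

/-- The map `A → ⨁ i, (A ⧸ I)_i` induced by the decomposition of `A`. -/
def toQuotientSum : A →ₗ[k] DirectSum ℕ (fun i ↦ quotientGrading 𝒜 I i) :=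
  (DirectSum.lmap fun i ↦ ((Ideal.Quotient.mkₐ k I.toIdeal).toLinearMap.restrict
    (p := 𝒜 i) (q := quotientGrading 𝒜 I i) fun a ha ↦ ⟨a, ha, rfl⟩)) ∘ₗ
    (DirectSum.decomposeLinearEquiv 𝒜).toLinearMap

theorem toQuotientSum_apply (a : A) (i : ℕ) :
    (toQuotientSum 𝒜 I a i : A ⧸ I.toIdeal) =
      Ideal.Quotient.mk I.toIdeal (DirectSum.decompose 𝒜 a i) := by
  simp [toQuotientSum, DirectSum.lmap_apply]
  rfl

theorem toQuotientSum_eq_zero {a : A} (ha : a ∈ I.toIdeal) : toQuotientSum 𝒜 I a = 0 := by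
  ext i
  rw [toQuotientSum_apply, DirectSum.zero_apply, ZeroMemClass.coe_zero,
    Ideal.Quotient.eq_zero_iff_mem]
  exact I.is_homogeneous' i ha

theorem toQuotientSum_of_mem {a : A} {i : ℕ} (ha : a ∈ 𝒜 i) :
    toQuotientSum 𝒜 I a =
      DirectSum.of (fun i ↦ quotientGrading 𝒜 I i) i ⟨Ideal.Quotient.mk I.toIdeal a, a, ha, rfl⟩ := by
  ext j
  rw [toQuotientSum_apply]
  by_cases hij : i = j
  · subst hij
    rw [DirectSum.decompose_of_mem_same 𝒜 ha, DirectSum.of_eq_same]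
  · rw [DirectSum.decompose_of_mem_ne 𝒜 ha hij, DirectSum.of_eq_of_ne _ _ _ (Ne.symm hij)]
    simp

/-- The map `A ⧸ I → ⨁ i, (A ⧸ I)_i` induced by the decomposition of `A`. -/
def quotientDecompose : A ⧸ I.toIdeal →+ DirectSum ℕ (fun i ↦ quotientGrading 𝒜 I i) :=
  QuotientAddGroup.lift I.toIdeal.toAddSubgroup (toQuotientSum 𝒜 I).toAddMonoidHom fun _ ha ↦
    toQuotientSum_eq_zero 𝒜 I ha

theorem quotientDecompose_mk (a : A) :
    quotientDecompose 𝒜 I (Ideal.Quotient.mk I.toIdeal a) = toQuotientSum 𝒜 I a := rfl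

instance : GradedAlgebra (quotientGrading 𝒜 I) where
  decompose' := quotientDecompose 𝒜 I
  left_inv x := by
    obtain ⟨a, rfl⟩ := Ideal.Quotient.mk_surjective x
    rw [quotientDecompose_mk]
    induction a using DirectSum.Decomposition.inductionOn 𝒜 with
    | zero => simp
    | homogeneous a => rw [toQuotientSum_of_mem 𝒜 I a.2, DirectSum.coeAddMonoidHom_of]
    | add a b ha hb => rw [map_add, map_add, map_add, ha, hb]
  right_inv x := by
    induction x using DirectSum.induction_on with
    | zero => rw [map_zero, map_zero]
    | add x y hx hy => rw [map_add, map_add, hx, hy]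
    | of i x =>
      obtain ⟨_, a, ha, rfl⟩ := x
      rw [DirectSum.coeAddMonoidHom_of]
      exact (quotientDecompose_mk 𝒜 I a).trans (toQuotientSum_of_mem 𝒜 I ha)

/-- The projection `A → A ⧸ I` as a homomorphism of graded rings. -/
def quotientMap : 𝒜 →+*ᵍ quotientGrading 𝒜 I where
  toRingHom := Ideal.Quotient.mk I.toIdeal
  map_mem ha := ⟨_, ha, rfl⟩

theorem irrelevant_le_map_quotientMap :
    HomogeneousIdeal.irrelevant (quotientGrading 𝒜 I) ≤
      (HomogeneousIdeal.irrelevant 𝒜).map (quotientMap 𝒜 I) := by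
  rw [← toIdeal_le_toIdeal_iff, HomogeneousIdeal.toIdeal_irrelevant_le]
  rintro i hi _ ⟨a, ha, rfl⟩
  exact Ideal.mem_map_of_mem (quotientMap 𝒜 I)
    ((HomogeneousIdeal.toIdeal_irrelevant_le 𝒜).1 le_rfl i hi ha)

/-- The closed immersion `Proj (A ⧸ I) ⟶ Proj A`. -/
def projQuotientι : Proj (quotientGrading 𝒜 I) ⟶ Proj 𝒜 :=
  Proj.map (quotientMap 𝒜 I) (irrelevant_le_map_quotientMap 𝒜 I)

end Quotient

/-! ### Projective space -/

section ProjectiveSpace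

variable (k : Type u) [Field k] (n : ℕ)

/-- The graded ring `S = k[x_0, …, x_n]`. -/
abbrev polyGrading : ℕ → Submodule k (MvPolynomial (Fin (n + 1)) k) :=
  MvPolynomial.homogeneousSubmodule (Fin (n + 1)) k

instance : GradedAlgebra (polyGrading k n) := MvPolynomial.gradedAlgebra

/-- Projective space `ℙⁿ` over `k`, as a scheme. -/
abbrev ProjSpace : Scheme.{u} := Proj (polyGrading k n)

/-- The structure morphism `ℙⁿ ⟶ Spec k`. -/
def projStructure : ProjSpace k n ⟶ Spec (.of k) :=
  Proj.toSpecZero (polyGrading k n) ≫ Spec.map (CommRingCat.ofHom (algebraMap k (polyGrading k n 0)))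

variable {k n}

/-- The homogeneous ideal generated by a homogeneous polynomial. -/
def principal {l : ℕ} {F : MvPolynomial (Fin (n + 1)) k} (hF : F ∈ polyGrading k n l) :
    HomogeneousIdeal (polyGrading k n) where
  toSubmodule := Ideal.span {F}
  is_homogeneous' := Ideal.homogeneous_span _ _ fun x hx ↦ by
    rw [Set.mem_singleton_iff.1 hx]; exact ⟨l, hF⟩

/-- The hypersurface `V(F) = Proj (S / F)`. -/
abbrev hypersurface {l : ℕ} {F : MvPolynomial (Fin (n + 1)) k} (hF : F ∈ polyGrading k n l) : Scheme.{u} :=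
  Proj (quotientGrading (polyGrading k n) (principal hF))

/-- The inclusion `V(F) ⟶ ℙⁿ`. -/
abbrev hypersurfaceι {l : ℕ} {F : MvPolynomial (Fin (n + 1)) k} (hF : F ∈ polyGrading k n l) :
    hypersurface hF ⟶ ProjSpace k n :=
  projQuotientι (polyGrading k n) (principal hF)

/-- The ideal sheaf `𝒥 = ker (ℐ → Ω_{ℙⁿ} / ℐ Ω_{ℙⁿ})` of a closed subscheme `i : C ⟶ ℙⁿ` with
ideal sheaf `ℐ`. -/
def idealSheafJ {C : Scheme.{u}} (i : C ⟶ ProjSpace k n) : (ProjSpace k n).IdealSheafData :=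
  conormalKernelSheaf (projStructure k n) i.ker

end ProjectiveSpace

end SingularAlong

end

open SingularAlong

/-!
The affine statement rests on the injectivity of `m / m² → Ω / m Ω` for a maximal ideal `m` whose
residue field is formally smooth over `k` (`mem_sq_of_D_mem`). It turns `f ∈ I`, `df ∈ I Ω` into
`f ∈ m²` for all `m ⊇ I`. Conversely `f ∈ m²` gives `df ∈ m Ω`; as `Ω` is projective and `I` is the
intersection of the maximal ideals above it, the intersection of the `m Ω` is `I Ω`. This is
`mem_and_D_mem_iff_forall_mem_sq`, which applies to the charts of `ℙⁿ`.

For the projective statement, let `f = F / x_i ^ l` be the local equation of `V(F)` at a point `x`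
of `D₊(x_i)`. The local ring of `ℙⁿ` at `x` is regular, so its quotient by `f ∈ m_x` fails to be
regular exactly when `f ∈ m_x²`, and that quotient is the local ring of `V(F)`
(`ker_localRingHom_quotientMap`, `mem_singularLocus_image_iff`).

* If `V(F)` is singular along `C`, then `f ∈ m²` for all closed points of `C` in the chart, so `f`
  is a section of `𝒥` by the affine statement (`chartEquation_mem`).
* If `F` is a section of `𝒥(l)`, then `f ∈ m_x²` at every point `x` of `C`. For points that are not
  closed this uses that the residue field, being finitely generated over the perfect field `k`, is
  formally smooth (`evalHom_mem_sq`).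
-/

namespace SingularAlong

/-! ### Differentials and squares of ideals -/

section Differentials

open IsLocalRing

/-- If `B ⧸ m` is formally smooth over `k`, then `m / m² → Ω / m Ω` is injective: a section `σ` of
`B ⧸ m² → B ⧸ m` gives the derivation `b ↦ b - σ b` with values in `m / m²`, and the linear map on
`Ω` that it induces is a left inverse. -/
theorem mem_sq_of_D_mem {k B : Type*} [CommRing k] [CommRing B] [Algebra k B] (m : Ideal B)
    [Algebra.FormallySmooth k (B ⧸ m)] {f : B} (hf : f ∈ m)
    (hdf : KaehlerDifferential.D k B f ∈ m • (⊤ : Submodule B (Ω[B⁄k]))) : f ∈ m ^ 2 := by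
  let N : Ideal (B ⧸ m ^ 2) := m.map (Ideal.Quotient.mk (m ^ 2))
  have hN : N ^ 2 = ⊥ := by rw [← Ideal.map_pow, Ideal.map_quotient_self]
  obtain ⟨σ, hσ⟩ := Algebra.FormallySmooth.exists_lift (R := k) (A := B ⧸ m) (B := B ⧸ m ^ 2) N
    ⟨2, hN⟩ (Ideal.Quotient.liftₐ m ((Ideal.Quotient.mkₐ k N).comp (Ideal.Quotient.mkₐ k (m ^ 2)))
      fun a ha ↦ Ideal.Quotient.eq_zero_iff_mem.2 (Ideal.mem_map_of_mem _ ha))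
  have hmem (b : B) : Ideal.Quotient.mk (m ^ 2) b - σ (Ideal.Quotient.mk m b) ∈ N := by
    rw [← Ideal.Quotient.eq]
    exact (DFunLike.congr_fun hσ (Ideal.Quotient.mk m b)).symm
  have hmul (x y : B ⧸ m ^ 2) (hx : x ∈ N) (hy : y ∈ N) : x * y = 0 := by
    have h := Ideal.mul_mem_mul hx hy
    rwa [← pow_two, hN, Ideal.mem_bot] at h
  let δ : Derivation k B (B ⧸ m ^ 2) := Derivation.mk'
    ((Ideal.Quotient.mkₐ k (m ^ 2)).toLinearMap -
      (σ.comp (Ideal.Quotient.mkₐ k m)).toLinearMap) fun a b ↦ by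
    have h := hmul _ _ (hmem a) (hmem b)
    simp only [LinearMap.sub_apply, AlgHom.toLinearMap_apply, AlgHom.comp_apply,
      Ideal.Quotient.mkₐ_eq_mk, map_mul, Algebra.smul_def, Ideal.Quotient.algebraMap_eq]
    linear_combination -h
  have hδ (w : Ω[B⁄k]) : δ.liftKaehlerDifferential w ∈ N := by
    have hw : w ∈ Submodule.span B (Set.range (KaehlerDifferential.D k B)) := by
      rw [KaehlerDifferential.span_range_derivation]; trivial
    induction hw using Submodule.span_induction with
    | mem w hw =>
      obtain ⟨b, rfl⟩ := hw
      rw [Derivation.liftKaehlerDifferential_comp_D]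
      exact hmem b
    | zero => rw [map_zero]; exact zero_mem _
    | add v w _ _ hv hw => rw [map_add]; exact add_mem hv hw
    | smul a w _ hw =>
      rw [map_smul, Algebra.smul_def]
      exact Ideal.mul_mem_left _ _ hw
  have hzero : ∀ w ∈ m • (⊤ : Submodule B (Ω[B⁄k])), δ.liftKaehlerDifferential w = 0 := by
    intro w hw
    induction hw using Submodule.smul_induction_on' with
    | smul a ha w _ =>
      rw [map_smul, Algebra.smul_def]
      exact hmul _ _ (Ideal.mem_map_of_mem _ ha) (hδ w)
    | add v _ w _ hv hw => rw [map_add, hv, hw, add_zero]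
  have h := hzero _ hdf
  rw [Derivation.liftKaehlerDifferential_comp_D] at h
  change Ideal.Quotient.mk (m ^ 2) f - σ (Ideal.Quotient.mk m f) = 0 at h
  rwa [Ideal.Quotient.eq_zero_iff_mem.2 hf, map_zero, sub_zero, Ideal.Quotient.eq_zero_iff_mem] at h

/-- For projective `P`, membership in `I P` is tested on coordinates, hence on ideals `m i` with
intersection inside `I`. -/
theorem mem_smul_top_of_forall {A P ι : Type*} [CommRing A] [AddCommGroup P] [Module A P]
    [Module.Projective A P] (I : Ideal A) (m : ι → Ideal A) (hI : ⨅ i, m i ≤ I) (x : P)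
    (hx : ∀ i, x ∈ m i • (⊤ : Submodule A P)) : x ∈ I • (⊤ : Submodule A P) := by
  obtain ⟨s, hs⟩ := Module.projective_def.1 ‹Module.Projective A P›
  rw [← hs x, Finsupp.linearCombination_apply]
  refine sum_mem fun p _ ↦ Submodule.smul_mem_smul (hI (Ideal.mem_iInf.2 fun i ↦ ?_)) trivial
  have h := Submodule.mem_map_of_mem (f := (Finsupp.lapply p).comp s) (hx i)
  rw [Submodule.map_smul''] at h
  exact (Submodule.smul_le.2 fun r hr a _ ↦ Ideal.mul_mem_right a _ hr) h

theorem D_mem_of_mem_sq {k B : Type*} [CommRing k] [CommRing B] [Algebra k B] {m : Ideal B}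
    {f : B} (hf : f ∈ m ^ 2) :
    KaehlerDifferential.D k B f ∈ m • (⊤ : Submodule B (Ω[B⁄k])) := by
  rw [pow_two] at hf
  induction hf using Submodule.mul_induction_on' with
  | mem_mul_mem a ha b hb =>
    rw [Derivation.leibniz]
    exact add_mem (Submodule.smul_mem_smul ha trivial) (Submodule.smul_mem_smul hb trivial)
  | add a _ b _ ha hb => rw [map_add]; exact add_mem ha hb

/-- The affine statement for any finitely generated algebra with projective differentials: the
intersection of the `m Ω` over the maximal ideals `m ⊇ I` is `I Ω`. -/
theorem mem_and_D_mem_iff_forall_mem_sq {k B : Type*} [Field k] [PerfectField k]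
    [CommRing B] [Algebra k B] [Algebra.FiniteType k B] [Module.Projective B (Ω[B⁄k])]
    {I : Ideal B} (hI : I.IsRadical) (f : B) :
    (f ∈ I ∧ KaehlerDifferential.D k B f ∈ I • (⊤ : Submodule B (Ω[B⁄k]))) ↔
      ∀ m : Ideal B, m.IsMaximal → I ≤ m → f ∈ m ^ 2 := by
  constructor
  · rintro ⟨hf, hdf⟩ m hm hIm
    let _ : Field (B ⧸ m) := Ideal.Quotient.field m
    exact mem_sq_of_D_mem m (hIm hf) (Submodule.smul_mono_left hIm hdf)
  · intro h
    have : IsJacobsonRing B := isJacobsonRing_of_finiteType (A := k)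
    have hinf : ⨅ m : {m : Ideal B // m.IsMaximal ∧ I ≤ m}, (m : Ideal B) ≤ I := by
      conv_rhs => rw [← IsJacobsonRing.out ‹_› hI]
      exact le_sInf fun m hm ↦ iInf_le (fun m : {m : Ideal B // m.IsMaximal ∧ I ≤ m} ↦
        (m : Ideal B)) ⟨m, hm.2, hm.1⟩
    exact ⟨hinf (Ideal.mem_iInf.2 fun m ↦ Ideal.pow_le_self two_ne_zero (h m m.2.1 m.2.2)),
      mem_smul_top_of_forall I _ hinf _ fun m ↦ D_mem_of_mem_sq (h m m.2.1 m.2.2)⟩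

/-- Elements of the kernel of `I → Ω_B / I Ω_B` lie in the square of the maximal ideal of any local
ring over `B` centred on `V(I)` with formally smooth residue field. The local ring need not be that
of a closed point. -/
theorem mem_maximalIdeal_sq {k B L : Type*} [CommRing k] [CommRing B] [Algebra k B]
    [CommRing L] [IsLocalRing L] [Algebra k L] [Algebra.FormallySmooth k (ResidueField L)]
    (φ : B →ₐ[k] L) {I : Ideal B} (hI : I.map φ ≤ maximalIdeal L) {s : B} (hs : s ∈ I)
    (hds : KaehlerDifferential.D k B s ∈ I • (⊤ : Submodule B (Ω[B⁄k]))) :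
    φ s ∈ maximalIdeal L ^ 2 := by
  let _ : Algebra B L := φ.toRingHom.toAlgebra
  have : IsScalarTower k B L := .of_algebraMap_eq fun x ↦ (φ.commutes x).symm
  have : Algebra.FormallySmooth k (L ⧸ maximalIdeal L) := ‹_›
  refine mem_sq_of_D_mem (k := k) _ (hI (Ideal.mem_map_of_mem _ hs)) ?_
  have h (w) (hw : w ∈ I • (⊤ : Submodule B (Ω[B⁄k]))) :
      KaehlerDifferential.map k k B L w ∈ maximalIdeal L • (⊤ : Submodule L (Ω[L⁄k])) := by
    induction hw using Submodule.smul_induction_on' with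
    | smul a ha w _ =>
      rw [map_smul, ← IsScalarTower.algebraMap_smul L a]
      exact Submodule.smul_mem_smul (hI (Ideal.mem_map_of_mem φ ha)) trivial
    | add v _ w _ hv hw => rw [map_add]; exact add_mem hv hw
  simpa only [KaehlerDifferential.map_D] using! h _ hds

end Differentials

/-! ### Hypersurfaces in a regular local ring -/

section Regular

open IsLocalRing

/-- Dividing by an element of `m²` keeps the embedding dimension but lowers the dimension. -/
theorem not_isRegularLocalRing_quotient {L : Type*} [CommRing L] [IsDomain L] [IsLocalRing L]
    [IsNoetherianRing L] {f : L} (hf : f ≠ 0) (hfm : f ∈ maximalIdeal L ^ 2) :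
    ¬ IsRegularLocalRing (L ⧸ Ideal.span {f}) := by
  intro h
  let Q := L ⧸ Ideal.span {f}
  let mk : L →+* Q := Ideal.Quotient.mk _
  have hmk : Function.Surjective mk := Ideal.Quotient.mk_surjective
  have : IsLocalHom mk := .of_surjective mk hmk
  have fg : (maximalIdeal Q).FG := (maximalIdeal Q).fg_of_isNoetherianRing
  have hfin := Submodule.FG.finite_generators fg
  let G := (maximalIdeal Q).generators
  -- lift minimal generators of the maximal ideal of the quotient; together with `f` they generate
  -- the maximal ideal, and `f ∈ m ^ 2` is superfluous by Nakayama's lemma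
  let T : Set L := Function.surjInv hmk '' G
  have hTG : mk '' T = G := by
    rw [Set.image_image]; simp [Function.surjInv_eq]
  have hm : maximalIdeal L = Ideal.span T ⊔ Ideal.span {f} := by
    have h1 : (Ideal.span T).map mk = maximalIdeal Q := by
      rw [Ideal.map_span, hTG]; exact (maximalIdeal Q).span_generators
    have h2 := congr(Ideal.comap mk $h1)
    rw [Ideal.comap_map_of_surjective mk hmk, maximalIdeal_comap, ← RingHom.ker_eq_comap_bot,
      Ideal.mk_ker] at h2
    exact h2.symm
  have hspan : maximalIdeal L = Ideal.span T := by
    refine le_antisymm ?_ (hm ▸ le_sup_left)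
    refine Submodule.le_of_le_smul_of_le_jacobson_bot (I := maximalIdeal L)
      (maximalIdeal L).fg_of_isNoetherianRing (maximalIdeal_le_jacobson _) ?_
    conv_lhs => rw [hm]
    refine sup_le_sup_left ?_ _
    rw [Ideal.span_singleton_le_iff_mem, smul_eq_mul, ← pow_two]
    exact hfm
  have hle : (maximalIdeal L).spanFinrank ≤ (maximalIdeal Q).spanFinrank := by
    rw [hspan, ← Submodule.FG.generators_ncard fg]
    exact (Submodule.spanFinrank_span_le_ncard_of_finite (hfin.image _)).trans
      (Set.ncard_image_le hfin)
  have h1 := ringKrullDim_quotient_succ_le_of_nonZeroDivisor (mem_nonZeroDivisors_of_ne_zero hf)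
  have h2 := ringKrullDim_le_spanFinrank_maximalIdeal L
  have h3 := h1.trans h2
  rw [← (isRegularLocalRing_iff _).1 h] at h3
  have h4 : (maximalIdeal Q).spanFinrank + 1 ≤ (maximalIdeal L).spanFinrank := by
    exact_mod_cast h3
  omega

/-- Dividing a regular local ring by an element of `m` outside `m²` lowers both the embedding
dimension and the dimension by one. -/
theorem isRegularLocalRing_quotient {L : Type*} [CommRing L] [IsDomain L] [IsRegularLocalRing L]
    {f : L} (hf : f ≠ 0) (hfm : f ∈ maximalIdeal L) (hfm2 : f ∉ maximalIdeal L ^ 2) :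
    IsRegularLocalRing (L ⧸ Ideal.span {f}) := by
  let Q := L ⧸ Ideal.span {f}
  let mk : L →+* Q := Ideal.Quotient.mk _
  have hmk : Function.Surjective mk := Ideal.Quotient.mk_surjective
  have : Nontrivial Q := Ideal.Quotient.nontrivial_iff.2
    (ne_top_of_le_ne_top (maximalIdeal.isMaximal L).ne_top
      ((Ideal.span_singleton_le_iff_mem _).2 hfm))
  have : IsLocalRing Q := .of_surjective' mk hmk
  have : IsLocalHom mk := .of_surjective mk hmk
  let v : CotangentSpace L := (maximalIdeal L).toCotangent ⟨f, hfm⟩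
  have hv : v ≠ 0 := fun h ↦ hfm2 (((maximalIdeal L).toCotangent_eq_zero _).1 h)
  have hli : LinearIndepOn (ResidueField L) id {v} := LinearIndepOn.singleton hv
  -- complete the class of `f` to a basis of the cotangent space; lifts of the other vectors
  -- generate the maximal ideal of the quotient
  let b := Module.Basis.extend hli
  let E := hli.extend (Set.subset_univ _)
  have hvE : v ∈ E := hli.subset_extend _ rfl
  have hE : E.ncard = Module.finrank (ResidueField L) (CotangentSpace L) :=
    (Module.finrank_eq_nat_card_basis b).symm
  have hEfin : E.Finite := Module.Finite.finite_basis b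
  have hsurj := (maximalIdeal L).toCotangent_surjective
  let T : Set (maximalIdeal L) := Function.surjInv hsurj '' (E \ {v})
  have hT : (maximalIdeal L).toCotangent '' T = E \ {v} := by
    rw [Set.image_image]; simp [Function.surjInv_eq]
  have hspan : Submodule.span L (insert ⟨f, hfm⟩ T) = ⊤ := by
    rw [← CotangentSpace.span_image_eq_top_iff, Set.image_insert_eq, hT]
    change Submodule.span _ (insert v (E \ {v})) = ⊤
    rw [Set.insert_sdiff_singleton, Set.insert_eq_of_mem hvE, ← b.span_eq]
    simp [b, E]
  have hQ : maximalIdeal Q = Ideal.span (mk '' ((↑) '' T)) := by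
    have h1 := congr(Submodule.map (Submodule.subtype (maximalIdeal L)) $hspan)
    rw [Submodule.map_span, Set.image_insert_eq, Submodule.map_top, Submodule.range_subtype] at h1
    have h2 : (maximalIdeal L).map mk = maximalIdeal Q :=
      by
      rw [← maximalIdeal_comap mk, Ideal.map_comap_of_surjective mk hmk]
    rw [← h2]
    refine congr(Ideal.map mk $h1).symm.trans ?_
    change Ideal.map mk (Ideal.span _) = _
    rw [Ideal.map_span, Set.image_insert_eq, Ideal.span_insert]
    have h0 : mk f = 0 := Ideal.Quotient.eq_zero_iff_mem.2 (Ideal.mem_span_singleton_self f)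
    simp [h0]
  have hle : (maximalIdeal Q).spanFinrank + 1 ≤ (maximalIdeal L).spanFinrank := by
    rw [spanFinrank_maximalIdeal_eq_finrank_cotangentSpace L, ← hE,
      ← Set.ncard_sdiff_singleton_add_one hvE hEfin, hQ]
    have hfin : (E \ {v}).Finite := hEfin.sdiff
    have hTfin : T.Finite := hfin.image _
    gcongr
    exact (Submodule.spanFinrank_span_le_ncard_of_finite ((hTfin.image _).image _)).trans
      ((Set.ncard_image_le (hTfin.image _)).trans
        ((Set.ncard_image_le hTfin).trans (Set.ncard_image_le hfin)))
  refine .of_spanFinrank_maximalIdeal_le _ ?_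
  have h1 := Module.ringKrullDim_quotient_add_one_of_mem_nonZeroDivisors
    (mem_nonZeroDivisors_of_ne_zero hf) maximalIdeal_height_eq_ringKrullDim hfm
  rw [← (isRegularLocalRing_iff L).1 ‹_›] at h1
  by_contra hlt
  have h2 := ENat.WithBot.add_one_le_natCast_iff.2 (not_le.1 hlt)
  rw [h1] at h2
  have h3 : (maximalIdeal L).spanFinrank ≤ (maximalIdeal Q).spanFinrank := by exact_mod_cast h2
  omega

end Regular

/-! ### Points and local rings of `Proj (A ⧸ I)` -/

section ProjQuotient

open HomogeneousLocalization

variable {k : Type u} {A : Type u} [Field k] [CommRing A] [Algebra k A]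
  (𝒜 : ℕ → Submodule k A) [GradedAlgebra 𝒜] (I : HomogeneousIdeal 𝒜)

theorem pointIdeal_projQuotientι (y : Proj (quotientGrading 𝒜 I)) :
    pointIdeal 𝒜 (projQuotientι 𝒜 I y) =
      (pointIdeal (quotientGrading 𝒜 I) y).comap (quotientMap 𝒜 I) := rfl

theorem exists_projQuotientι_eq (x : Proj 𝒜) (hx : I.toIdeal ≤ pointIdeal 𝒜 x) :
    ∃ y, projQuotientι 𝒜 I y = x := by
  have hker : ((pointIdeal 𝒜 x).map (Ideal.Quotient.mk I.toIdeal)).comap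
      (Ideal.Quotient.mk I.toIdeal) = pointIdeal 𝒜 x := by
    rw [Ideal.comap_map_of_surjective _ Ideal.Quotient.mk_surjective, ← RingHom.ker_eq_comap_bot,
      Ideal.mk_ker, sup_eq_left]
    exact hx
  refine ⟨⟨x.asHomogeneousIdeal.map (quotientMap 𝒜 I), ?_, fun h ↦ x.not_irrelevant_le ?_⟩, ?_⟩
  · refine Ideal.map_isPrime_of_surjective (I := pointIdeal 𝒜 x) Ideal.Quotient.mk_surjective ?_
    rw [Ideal.mk_ker]; exact hx
  · rw [← toIdeal_le_toIdeal_iff, HomogeneousIdeal.toIdeal_irrelevant_le] at h ⊢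
    intro i hi a ha
    have ha' : a ∈ ((pointIdeal 𝒜 x).map (Ideal.Quotient.mk I.toIdeal)).comap
        (Ideal.Quotient.mk I.toIdeal) := h i hi ⟨a, ha, rfl⟩
    rwa [hker] at ha'
  · exact ProjectiveSpectrum.ext (HomogeneousIdeal.toIdeal_injective hker)

theorem localRingHom_quotientMap_surjective (y : Proj (quotientGrading 𝒜 I)) :
    Function.Surjective (localRingHom (quotientMap 𝒜 I) _ _ (pointIdeal_projQuotientι 𝒜 I y)) := by
  intro z
  obtain ⟨⟨d, ⟨_, a, ha, rfl⟩, ⟨_, b, hb, rfl⟩, hbz⟩, rfl⟩ := mk_surjective z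
  refine ⟨.mk ⟨d, ⟨a, ha⟩, ⟨b, hb⟩, hbz⟩, ?_⟩
  rfl

/-- The closed subscheme `Proj (A ⧸ F)` is cut out in the local ring of `Proj A` by the fraction
`F / b`, for any homogeneous `b` of the degree of `F` that does not vanish at the point. -/
theorem ker_localRingHom_quotientMap (y : Proj (quotientGrading 𝒜 I)) {l : ℕ} {F b : A}
    (hF : F ∈ 𝒜 l) (hb : b ∈ 𝒜 l) (hI : I.toIdeal = Ideal.span {F})
    (hby : b ∉ pointIdeal 𝒜 (projQuotientι 𝒜 I y)) :
    RingHom.ker (localRingHom (quotientMap 𝒜 I) _ _ (pointIdeal_projQuotientι 𝒜 I y)) =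
      Ideal.span {HomogeneousLocalization.mk ⟨l, ⟨F, hF⟩, ⟨b, hb⟩, hby⟩} := by
  apply le_antisymm
  · intro z hz
    obtain ⟨⟨d, ⟨a, ha⟩, ⟨c, hc⟩, hcz⟩, rfl⟩ := mk_surjective z
    have h0 : Localization.mk (S := (pointIdeal (quotientGrading 𝒜 I) y).primeCompl)
        (Ideal.Quotient.mk I.toIdeal a) ⟨Ideal.Quotient.mk I.toIdeal c, hcz⟩ = 0 :=
      (congr_arg HomogeneousLocalization.val (RingHom.mem_ker.1 hz)).trans
        HomogeneousLocalization.val_zero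
    rw [← Localization.mk_zero 1, Localization.mk_eq_mk_iff, Localization.r_iff_exists] at h0
    obtain ⟨⟨t, ht⟩, h0⟩ := h0
    obtain ⟨t, rfl⟩ := Ideal.Quotient.mk_surjective t
    -- replace `t` by a homogeneous component outside the prime ideal of the point
    obtain ⟨e, he⟩ : ∃ e, (DirectSum.decompose 𝒜 t e : A) ∉
        pointIdeal 𝒜 (projQuotientι 𝒜 I y) := by
      classical
      by_contra! h
      refine ht ?_
      change Ideal.Quotient.mk I.toIdeal t ∈ pointIdeal (quotientGrading 𝒜 I) y
      rw [← DirectSum.sum_support_decompose 𝒜 t, map_sum]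
      exact sum_mem fun e _ ↦ h e
    have hta : t * a ∈ I.toIdeal := by
      simpa [← map_mul, Ideal.Quotient.eq_zero_iff_mem] using h0
    have hta' : (DirectSum.decompose 𝒜 (t * a) (e + d) : A) ∈ I.toIdeal :=
      I.is_homogeneous' (e + d) hta
    rw [DirectSum.coe_decompose_mul_add_of_right_mem 𝒜 ha] at hta'
    rw [hI, Ideal.mem_span_singleton] at hta'
    obtain ⟨g, hg⟩ := hta'
    set t' := DirectSum.decompose 𝒜 t e
    have hta'' : (t' : A) * a ∈ 𝒜 (e + d) := SetLike.mul_mem_graded t'.2 ha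
    have hdec : (t' : A) * a = DirectSum.decompose 𝒜 (F * g) (e + d) := by
      rw [← hg, DirectSum.decompose_of_mem_same 𝒜 hta'']
    by_cases hl : l ≤ e + d
    · rw [DirectSum.coe_decompose_mul_of_left_mem_of_le 𝒜 hF hl] at hdec
      set g' := DirectSum.decompose 𝒜 g (e + d - l)
      rw [Ideal.mem_span_singleton]
      refine ⟨.mk ⟨e + d, ⟨b * g', ?_⟩, ⟨t' * c, SetLike.mul_mem_graded t'.2 hc⟩,
        mul_mem he hcz⟩, ?_⟩
      · have h := SetLike.mul_mem_graded hb g'.2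
        rwa [Nat.add_sub_cancel' hl] at h
      · apply HomogeneousLocalization.val_injective
        rw [HomogeneousLocalization.val_mul]
        simp only [HomogeneousLocalization.val_mk, Localization.mk_mul]
        rw [Localization.mk_eq_mk_iff, Localization.r_iff_exists]
        refine ⟨1, ?_⟩
        simp only [OneMemClass.coe_one, Submonoid.coe_mul, one_mul]
        linear_combination b * c * hdec
    · rw [DirectSum.coe_decompose_mul_of_left_mem_of_not_le 𝒜 hF hl] at hdec
      refine Set.mem_of_eq_of_mem ?_ (zero_mem (Ideal.span _))
      apply HomogeneousLocalization.val_injective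
      rw [HomogeneousLocalization.val_zero, HomogeneousLocalization.val_mk,
        ← Localization.mk_zero 1, Localization.mk_eq_mk_iff, Localization.r_iff_exists]
      exact ⟨⟨t', he⟩, by simp [hdec]⟩
  · rw [Ideal.span_singleton_le_iff_mem, RingHom.mem_ker]
    refine HomogeneousLocalization.mk_eq_zero_of_num _ (Subtype.ext ?_)
    exact Ideal.Quotient.eq_zero_iff_mem.2 (hI.ge (Ideal.mem_span_singleton_self F))

end ProjQuotient

/-! ### The standard charts of `ℙⁿ` as polynomial rings -/

section Dehomogenization

open HomogeneousLocalization

variable (k : Type u) [Field k] (n : ℕ) (i : Fin (n + 1))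

theorem X_mem_polyGrading : (MvPolynomial.X i : MvPolynomial (Fin (n + 1)) k) ∈ polyGrading k n 1 :=
  MvPolynomial.isHomogeneous_X k i

/-- The inclusion of `k` in a homogeneous localization of `k[x_0, …, x_n]`. It is a ring
homomorphism rather than an `Algebra` instance, since homogeneous localizations carry another
action of `k`. -/
noncomputable def scalarHom (W : Submonoid (MvPolynomial (Fin (n + 1)) k)) :
    k →+* HomogeneousLocalization (polyGrading k n) W :=
  (fromZeroRingHom (polyGrading k n) W).comp (algebraMap k (polyGrading k n 0))

theorem val_scalarHom (W : Submonoid (MvPolynomial (Fin (n + 1)) k)) (c : k) :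
    (scalarHom k n W c).val =
      algebraMap (MvPolynomial (Fin (n + 1)) k) (Localization W) (MvPolynomial.C c) :=
  Localization.mk_one_eq_algebraMap _

/-- The homomorphism `k[y_1, …, y_n] → (S_{x_i})_0` that sends the variables to the `x_j / x_i`,
`j ≠ i`. -/
noncomputable def polyToAway :
    MvPolynomial (Fin n) k →+* Away (polyGrading k n) (MvPolynomial.X i) :=
  MvPolynomial.eval₂Hom (scalarHom k n _) fun j ↦
    Away.mk _ (X_mem_polyGrading k n i) 1 (MvPolynomial.X (i.succAbove j)) (by
      simpa using X_mem_polyGrading k n (i.succAbove j))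

/-- Dehomogenization: `x_i ↦ 1`, and the other variables go to `y_1, …, y_n` in order. -/
noncomputable def dehomogenize : MvPolynomial (Fin (n + 1)) k →ₐ[k] MvPolynomial (Fin n) k :=
  MvPolynomial.aeval (i.insertNth (α := fun _ ↦ MvPolynomial (Fin n) k) 1 MvPolynomial.X)

/-- If `χ x_j · u = θ x_j` for all `j`, then `χ a · u ^ m = θ a` for `a` homogeneous of
degree `m`. -/
theorem map_mul_pow_of_isHomogeneous {σ R L : Type*} [CommRing R] [CommRing L]
    (χ θ : MvPolynomial σ R →+* L) (u : L) (hC : ∀ c, χ (MvPolynomial.C c) = θ (MvPolynomial.C c))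
    (hX : ∀ j, χ (MvPolynomial.X j) * u = θ (MvPolynomial.X j)) {m : ℕ} {a : MvPolynomial σ R}
    (ha : a.IsHomogeneous m) : χ a * u ^ m = θ a := by
  rw [a.as_sum, map_sum, map_sum, Finset.sum_mul]
  refine Finset.sum_congr rfl fun d hd ↦ ?_
  have hdm : m = d.sum fun _ e ↦ e := by
    rw [← ha (MvPolynomial.mem_support_iff.1 hd), Finsupp.weight_apply]; simp
  rw [MvPolynomial.monomial_eq, map_mul, map_mul, hC, mul_assoc, hdm, Finsupp.prod, Finsupp.sum,
    map_prod, map_prod, ← Finset.prod_pow_eq_pow_sum, ← Finset.prod_mul_distrib]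
  simp only [map_pow, ← mul_pow, hX]

theorem polyToAway_bijective : Function.Bijective (polyToAway k n i) := by
  constructor
  · have hu : IsUnit ((dehomogenize k n i).toRingHom (MvPolynomial.X i)) := by
      simp [dehomogenize]
    -- dehomogenization extends to `S_{x_i}`, and restricts to a left inverse
    let ψ : Away (polyGrading k n) (MvPolynomial.X i) →+* MvPolynomial (Fin n) k :=
      (IsLocalization.Away.lift (S := Localization.Away (MvPolynomial.X i))
        (MvPolynomial.X i) hu).comp
        (algebraMap (Away (polyGrading k n) (MvPolynomial.X i))
          (Localization.Away (MvPolynomial.X i : MvPolynomial (Fin (n + 1)) k)))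
    have h : ψ.comp (polyToAway k n i) = RingHom.id _ := by
      apply MvPolynomial.ringHom_ext
      · intro c
        simp [ψ, polyToAway, val_scalarHom, HomogeneousLocalization.algebraMap_apply, dehomogenize]
      · intro j
        simp [ψ, polyToAway, HomogeneousLocalization.algebraMap_apply]
        rw [Localization.mk_eq_mk', IsLocalization.Away.lift, IsLocalization.lift_mk'_spec]
        simp [dehomogenize]
    exact Function.LeftInverse.injective (g := ψ) fun x ↦ DFunLike.congr_fun h x
  · intro z
    obtain ⟨m, a, ha, rfl⟩ := Away.mk_surjective _ (X_mem_polyGrading k n i) z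
    refine ⟨dehomogenize k n i a, ?_⟩
    apply HomogeneousLocalization.val_injective
    have h := map_mul_pow_of_isHomogeneous
      ((algebraMap (Away (polyGrading k n) (MvPolynomial.X i))
        (Localization.Away (MvPolynomial.X i : MvPolynomial (Fin (n + 1)) k))).comp
        ((polyToAway k n i).comp (dehomogenize k n i).toRingHom))
      (algebraMap _ (Localization.Away (MvPolynomial.X i : MvPolynomial (Fin (n + 1)) k)))
      (algebraMap (MvPolynomial (Fin (n + 1)) k) _ (MvPolynomial.X i)) ?_ ?_
      (m := m) (a := a) (by simpa using ha)
    · rw [Away.val_mk, Localization.mk_eq_mk', IsLocalization.eq_mk'_iff_mul_eq]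
      simpa using h
    · intro c
      simp [polyToAway, dehomogenize, val_scalarHom]
    · intro j
      refine Fin.succAboveCases i ?_ (fun j ↦ ?_) j
      · simp [polyToAway, dehomogenize]
      · simp [polyToAway, dehomogenize]
        rw [Localization.mk_eq_mk']
        exact IsLocalization.mk'_spec (M := Submonoid.powers (MvPolynomial.X i))
          (Localization.Away (MvPolynomial.X i)) (MvPolynomial.X (i.succAbove j))
          ⟨MvPolynomial.X i, _⟩

end Dehomogenization

/-! ### The structure morphism of `ℙⁿ` on sections -/

section StructureMorphism

open HomogeneousLocalization

variable (k : Type u) [Field k] (n : ℕ)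

/-- A section of the inclusion of an open subscheme `V = ⊤` acts on global sections as a
transport. -/
theorem topIso_inv_appTop {X : Scheme.{u}} {V : X.Opens} (hV : V = ⊤) (e : X ⟶ V)
    (he : e ≫ V.ι = 𝟙 X) :
    V.topIso.inv ≫ e.appTop = X.presheaf.map (eqToHom hV.symm).op := by
  subst hV
  have h := congr($(he).appTop)
  rw [Scheme.Hom.comp_appTop] at h
  simp at h ⊢
  exact h

theorem toSpecZero_appTop {σ A : Type u} [CommRing A] [SetLike σ A] [AddSubgroupClass σ A]
    (𝒜 : ℕ → σ) [GradedRing 𝒜] : (Proj.toSpecZero 𝒜).appTop = (Scheme.ΓSpecIso _).hom ≫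
      CommRingCat.ofHom (fromZeroRingHom 𝒜 _) ≫ Proj.awayToSection 𝒜 1 ≫
        (Proj 𝒜).presheaf.map (eqToHom (Proj.basicOpen_one 𝒜).symm).op := by
  rw [← topIso_inv_appTop (Proj.basicOpen_one 𝒜) ((Scheme.topIso _).inv ≫
    (Scheme.isoOfEq _ (Proj.basicOpen_one 𝒜)).inv) (by simp), Proj.toSpecZero]
  have h : (Proj.basicOpenToSpec 𝒜 1).appTop = _ := Proj.basicOpenToSpec_app_top 𝒜 1
  simp only [Scheme.Hom.comp_appTop, Category.assoc]
  rw [h]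
  simp
  rfl

theorem structureRingHom_apply (U : (ProjSpace k n).Opens) (c : k) (y : U) :
    (structureRingHom (projStructure k n) U c).1 y = scalarHom k n _ c := by
  have h : structureRingHom (projStructure k n) U =
      ((ProjSpace k n).presheaf.map (homOfLE le_top).op).hom.comp
        ((Proj.awayToSection (polyGrading k n) 1 ≫ (ProjSpace k n).presheaf.map
          (eqToHom (Proj.basicOpen_one _).symm).op).hom.comp (scalarHom k n _)) := by
    rw [structureRingHom]
    rw [← CommRingCat.hom_ofHom (scalarHom k n _), ← CommRingCat.hom_comp, ← CommRingCat.hom_comp]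
    congr 1
    change _ ≫ (projStructure k n).appTop ≫ _ = _
    rw [projStructure, Scheme.Hom.comp_appTop, toSpecZero_appTop]
    simp
    rfl
  rw [h]
  apply HomogeneousLocalization.val_injective
  rw [val_scalarHom]
  rfl

end StructureMorphism

/-! ### Local rings of `Proj` and values of sections -/

section LocalRing

open HomogeneousLocalization IsLocalRing

variable {σ A : Type u} [CommRing A] [SetLike σ A] [AddSubgroupClass σ A] (𝒜 : ℕ → σ) [GradedRing 𝒜]

/-- The local ring of `Proj 𝒜` at `x`, as the homogeneous localization at the prime ideal of `x`. -/
abbrev LocalRing (x : Proj 𝒜) : Type u := HomogeneousLocalization.AtPrime 𝒜 (pointIdeal 𝒜 x)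

/-- The germ at `x` of a section of the structure sheaf, in the homogeneous localization. -/
def evalHom (U : (Proj 𝒜).Opens) (x : U) : Γ(Proj 𝒜, U) →+* LocalRing 𝒜 (x : Proj 𝒜) where
  toFun s := s.1 x
  map_one' := rfl
  map_mul' _ _ := rfl
  map_zero' := rfl
  map_add' _ _ := rfl

/-- The stalk of the structure sheaf is the homogeneous localization. -/
noncomputable def stalkEquiv (x : Proj 𝒜) : (Proj 𝒜).presheaf.stalk x ≃+* LocalRing 𝒜 x :=
  (Proj.stalkIso 𝒜 x).commRingCatIsoToRingEquiv

theorem stalkEquiv_germ (U : (Proj 𝒜).Opens) (x : U) (s : Γ(Proj 𝒜, U)) :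
    stalkEquiv 𝒜 (x : Proj 𝒜) ((Proj 𝒜).presheaf.germ U x x.2 s) = evalHom 𝒜 U x s :=
  Proj.stalkIso'_germ 𝒜 U x.1 x.2 s

theorem isLocalization_evalHom {U : (Proj 𝒜).Opens} (hU : IsAffineOpen U) (x : U) :
    letI := (evalHom 𝒜 U x).toAlgebra
    IsLocalization.AtPrime (LocalRing 𝒜 (x : Proj 𝒜)) (hU.primeIdealOf x).asIdeal := by
  let _ := (evalHom 𝒜 U x).toAlgebra
  let _ := (Proj 𝒜).presheaf.algebra_section_stalk x
  have := hU.isLocalization_stalk x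
  exact IsLocalization.isLocalization_of_algEquiv (hU.primeIdealOf x).asIdeal.primeCompl
    (AlgEquiv.ofRingEquiv (f := stalkEquiv 𝒜 (x : Proj 𝒜)) fun s ↦ stalkEquiv_germ 𝒜 U x s)

theorem mem_zeroLocus_iff_evalHom {U : (Proj 𝒜).Opens} (x : U) (I : Ideal Γ(Proj 𝒜, U)) :
    (x : Proj 𝒜) ∈ (Proj 𝒜).zeroLocus (U := U) (I : Set Γ(Proj 𝒜, U)) ↔
      ∀ s ∈ I, evalHom 𝒜 U x s ∈ maximalIdeal (LocalRing 𝒜 (x : Proj 𝒜)) := by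
  rw [Scheme.mem_zeroLocus_iff]
  refine forall₂_congr fun s _ ↦ ?_
  rw [Scheme.mem_basicOpen _ _ _ x.2, mem_maximalIdeal, mem_nonunits_iff, ← stalkEquiv_germ,
    MulEquiv.isUnit_map (stalkEquiv 𝒜 (x : Proj 𝒜))]

end LocalRing

open IsLocalRing in
/-- The ideal `m²` is primary for maximal `m`, so it is contracted from the localization. -/
theorem mem_sq_of_map_mem_maximalIdeal_sq {B L : Type*} [CommRing B] [CommRing L] [IsLocalRing L]
    [Algebra B L] (m : Ideal B) [hm : m.IsMaximal] [IsLocalization.AtPrime L m] {f : B}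
    (hf : algebraMap B L f ∈ maximalIdeal L ^ 2) : f ∈ m ^ 2 := by
  have hrad : (m ^ 2).radical = m := by rw [Ideal.radical_pow _ two_ne_zero, hm.isPrime.radical]
  have hprim : (m ^ 2).IsPrimary := Ideal.isPrimary_of_isMaximal_radical (hrad.symm ▸ hm)
  rw [← IsLocalization.AtPrime.map_eq_maximalIdeal m L, ← Ideal.map_pow] at hf
  rw [← IsLocalization.under_map_of_isPrimary_disjoint m.primeCompl L hprim
    (Set.disjoint_left.2 fun a ha ha' ↦ ha (Ideal.pow_le_self two_ne_zero ha'))]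
  exact hf

/-! ### The local rings of `ℙⁿ` -/

section Chart

open HomogeneousLocalization IsLocalRing

variable (k : Type u) [Field k] (n : ℕ) (i : Fin (n + 1))

/-- The standard chart `D₊(x_i)` of `ℙⁿ`. -/
noncomputable def chart : (ProjSpace k n).affineOpens :=
  ⟨Proj.basicOpen (polyGrading k n) (MvPolynomial.X i),
    Proj.isAffineOpen_basicOpen _ _ (X_mem_polyGrading k n i) one_pos⟩

theorem exists_mem_chart (x : ProjSpace k n) :
    ∃ i, x ∈ (chart k n i : (ProjSpace k n).Opens) := by
  by_contra! h
  refine x.not_irrelevant_le ?_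
  rw [← toIdeal_le_toIdeal_iff, HomogeneousIdeal.toIdeal_irrelevant_le]
  intro d hd a ha
  have hX : Ideal.span (MvPolynomial.X '' Set.univ) ≤ pointIdeal (polyGrading k n) x := by
    rw [Ideal.span_le]
    rintro _ ⟨j, -, rfl⟩
    exact not_not.1 (h j)
  refine hX (MvPolynomial.mem_ideal_span_X_image.2 fun m hm ↦ ?_)
  have hdeg := ha (MvPolynomial.mem_support_iff.1 hm)
  by_contra! h0
  have hm0 : m = 0 := Finsupp.ext fun j ↦ h0 j trivial
  rw [hm0, map_zero] at hdeg
  exact hd.ne hdeg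

/-- The coordinate ring of `D₊(x_i)` is a polynomial ring in `n` variables. -/
noncomputable def chartEquiv : MvPolynomial (Fin n) k ≃+* Γ(ProjSpace k n, chart k n i) :=
  (RingEquiv.ofBijective _ (polyToAway_bijective k n i)).trans
    (Proj.basicOpenIsoAway (polyGrading k n) (MvPolynomial.X i) (X_mem_polyGrading k n i)
      one_pos).commRingCatIsoToRingEquiv

theorem chartEquiv_C (c : k) : chartEquiv k n i (MvPolynomial.C c) =
    structureRingHom (projStructure k n) (chart k n i) c := by
  apply Subtype.ext
  funext y
  refine Eq.trans ?_ (structureRingHom_apply k n (chart k n i) c y).symm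
  apply HomogeneousLocalization.val_injective
  have h : chartEquiv k n i (MvPolynomial.C c) =
      Proj.awayToSection (polyGrading k n) (MvPolynomial.X i) (scalarHom k n _ c) := by
    change Proj.awayToSection (polyGrading k n) (MvPolynomial.X i) (polyToAway k n i _) = _
    simp [polyToAway]
  rw [h]
  rfl

/-- The equivalence `chartEquiv` as one of `k`-algebras. -/
noncomputable def chartAlgEquiv :
    letI : Algebra k Γ(ProjSpace k n, chart k n i) :=
      (structureRingHom (projStructure k n) (chart k n i)).toAlgebra
    MvPolynomial (Fin n) k ≃ₐ[k] Γ(ProjSpace k n, chart k n i) :=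
  letI : Algebra k Γ(ProjSpace k n, chart k n i) :=
      (structureRingHom (projStructure k n) (chart k n i)).toAlgebra
  AlgEquiv.ofRingEquiv (f := chartEquiv k n i) (chartEquiv_C k n i)

instance (x : ProjSpace k n) : IsDomain (LocalRing (polyGrading k n) x) := by
  have hinj := HomogeneousLocalization.val_injective (𝒜 := polyGrading k n)
    (pointIdeal (polyGrading k n) x).primeCompl
  have : IsDomain (Localization.AtPrime (pointIdeal (polyGrading k n) x)) := inferInstance
  exact Function.Injective.isDomain
    (algebraMap (LocalRing (polyGrading k n) x)
      (Localization.AtPrime (pointIdeal (polyGrading k n) x))) hinj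

instance (x : ProjSpace k n) : IsRegularLocalRing (LocalRing (polyGrading k n) x) := by
  obtain ⟨i, hi⟩ := exists_mem_chart k n x
  have : IsRegularRing Γ(ProjSpace k n, chart k n i) := .of_ringEquiv (chartEquiv k n i)
  let _ := (evalHom (polyGrading k n) _ ⟨x, hi⟩).toAlgebra
  have := isLocalization_evalHom (polyGrading k n) (chart k n i).2 ⟨x, hi⟩
  let p := ((chart k n i).2.primeIdealOf ⟨x, hi⟩).asIdeal
  exact .of_ringEquiv (IsLocalization.algEquiv p.primeCompl (Localization.AtPrime p)
    (LocalRing (polyGrading k n) x)).toRingEquiv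

/-- Residue fields of `ℙⁿ` at arbitrary points are finitely generated extensions of `k`, so they are
formally smooth over a perfect field. -/
theorem formallySmooth_residueField [PerfectField k] (x : ProjSpace k n) :
    letI : Algebra k (LocalRing (polyGrading k n) x) := (scalarHom k n _).toAlgebra
    Algebra.FormallySmooth k (ResidueField (LocalRing (polyGrading k n) x)) := by
  obtain ⟨i, hi⟩ := exists_mem_chart k n x
  let _ : Algebra k (LocalRing (polyGrading k n) x) := (scalarHom k n _).toAlgebra
  let _ : Algebra k Γ(ProjSpace k n, chart k n i) :=
      (structureRingHom (projStructure k n) (chart k n i)).toAlgebra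
  have : Algebra.FiniteType k Γ(ProjSpace k n, chart k n i) :=
    .equiv inferInstance (chartAlgEquiv k n i)
  let _ := (evalHom (polyGrading k n) _ ⟨x, hi⟩).toAlgebra
  have := isLocalization_evalHom (polyGrading k n) (chart k n i).2 ⟨x, hi⟩
  have := IsScalarTower.of_algebraMap_eq (R := k) (S := Γ(ProjSpace k n, chart k n i))
    (A := LocalRing (polyGrading k n) x) fun c ↦ (structureRingHom_apply k n _ c ⟨x, hi⟩).symm
  have : Algebra.EssFiniteType Γ(ProjSpace k n, chart k n i) (LocalRing (polyGrading k n) x) :=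
    .of_isLocalization _ ((chart k n i).2.primeIdealOf ⟨x, hi⟩).asIdeal.primeCompl
  have := Algebra.EssFiniteType.comp k Γ(ProjSpace k n, chart k n i) (LocalRing (polyGrading k n) x)
  have := Algebra.EssFiniteType.comp k (LocalRing (polyGrading k n) x)
    (ResidueField (LocalRing (polyGrading k n) x))
  infer_instance

end Chart

/-! ### Singular points of hypersurfaces -/

section Hypersurface

open HomogeneousLocalization IsLocalRing

variable {k : Type u} [Field k] {n : ℕ}

theorem X_pow_mem_polyGrading (i : Fin (n + 1)) (l : ℕ) :
    (MvPolynomial.X i ^ l : MvPolynomial (Fin (n + 1)) k) ∈ polyGrading k n l := by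
  simpa using SetLike.pow_mem_graded l (X_mem_polyGrading k n i)

/-- The local equation `F / x_i ^ l` of `V(F)` at a point `x` of `D₊(x_i)`. -/
noncomputable def localEquation {l : ℕ} {F : MvPolynomial (Fin (n + 1)) k}
    (hF : F ∈ polyGrading k n l) (i : Fin (n + 1)) (x : ProjSpace k n)
    (hx : x ∈ (chart k n i : (ProjSpace k n).Opens)) : LocalRing (polyGrading k n) x :=
  .mk ⟨l, ⟨F, hF⟩, ⟨_, X_pow_mem_polyGrading i l⟩,
    (pointIdeal (polyGrading k n) x).primeCompl.pow_mem hx l⟩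

variable {l : ℕ} {F : MvPolynomial (Fin (n + 1)) k} (hF : F ∈ polyGrading k n l)
  (i : Fin (n + 1))

theorem val_localEquation (x : ProjSpace k n) (hx : x ∈ (chart k n i : (ProjSpace k n).Opens)) :
    (localEquation hF i x hx).val *
        algebraMap (MvPolynomial (Fin (n + 1)) k) _ (MvPolynomial.X i ^ l) =
      algebraMap (MvPolynomial (Fin (n + 1)) k) _ F := by
  rw [localEquation, HomogeneousLocalization.val_mk, Localization.mk_eq_mk']
  exact IsLocalization.mk'_spec (M := (pointIdeal (polyGrading k n) x).primeCompl) _ F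
    ⟨MvPolynomial.X i ^ l, _⟩

theorem localEquation_ne_zero (hF0 : F ≠ 0) (x : ProjSpace k n)
    (hx : x ∈ (chart k n i : (ProjSpace k n).Opens)) : localEquation hF i x hx ≠ 0 := by
  intro h
  have h' := val_localEquation hF i x hx
  rw [h, HomogeneousLocalization.val_zero, zero_mul] at h'
  exact hF0 (IsLocalization.injective (Localization.AtPrime (pointIdeal (polyGrading k n) x))
    (pointIdeal (polyGrading k n) x).primeCompl_le_nonZeroDivisors
    (h'.symm.trans (map_zero _).symm))

theorem localEquation_mem_maximalIdeal (x : ProjSpace k n)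
    (hx : x ∈ (chart k n i : (ProjSpace k n).Opens)) :
    localEquation hF i x hx ∈ maximalIdeal _ ↔ F ∈ pointIdeal (polyGrading k n) x := by
  rw [mem_maximalIdeal, mem_nonunits_iff, ← HomogeneousLocalization.isUnit_iff_isUnit_val,
    localEquation, HomogeneousLocalization.val_mk, Localization.mk_eq_mk',
    IsLocalization.AtPrime.isUnit_mk'_iff _ (pointIdeal (polyGrading k n) x)]
  exact not_not

theorem isRegularLocalRing_stalk_hypersurface_iff (y : hypersurface hF)
    (hx : hypersurfaceι hF y ∈ (chart k n i : (ProjSpace k n).Opens)) :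
    IsRegularLocalRing ((hypersurface hF).presheaf.stalk y) ↔
      IsRegularLocalRing (LocalRing (polyGrading k n) (hypersurfaceι hF y) ⧸
        Ideal.span {localEquation hF i _ hx}) := by
  let φ := localRingHom (quotientMap (polyGrading k n) (principal hF)) _ _
    (pointIdeal_projQuotientι _ (principal hF) y)
  have hker : RingHom.ker φ = Ideal.span {localEquation hF i _ hx} :=
    ker_localRingHom_quotientMap _ (principal hF) y hF (X_pow_mem_polyGrading i l) rfl _
  let e := (Ideal.quotEquivOfEq hker).symm.trans ((RingHom.quotientKerEquivOfSurjective
    (localRingHom_quotientMap_surjective _ (principal hF) y)).trans (stalkEquiv _ y).symm)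
  exact ⟨fun _ ↦ .of_ringEquiv e.symm, fun _ ↦ .of_ringEquiv e⟩

/-- At every point of `ℙⁿ`, closed or not, `V(F)` is singular if and only if its local equation lies
in the square of the maximal ideal. In particular `F` then vanishes at the point. -/
theorem mem_singularLocus_image_iff (hF0 : F ≠ 0) (x : ProjSpace k n)
    (hx : x ∈ (chart k n i : (ProjSpace k n).Opens)) :
    x ∈ hypersurfaceι hF '' singularLocus (hypersurface hF) ↔
      localEquation hF i x hx ∈ maximalIdeal (LocalRing (polyGrading k n) x) ^ 2 := by
  constructor
  · rintro ⟨y, hy, rfl⟩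
    by_contra h
    refine hy ((isRegularLocalRing_stalk_hypersurface_iff hF i y hx).2
      (isRegularLocalRing_quotient (localEquation_ne_zero hF i hF0 _ hx) ?_ h))
    rw [localEquation_mem_maximalIdeal, pointIdeal_projQuotientι, Ideal.mem_comap]
    refine Set.mem_of_eq_of_mem ?_ (zero_mem (pointIdeal _ y))
    exact Ideal.Quotient.eq_zero_iff_mem.2 (Ideal.mem_span_singleton_self F)
  · intro h
    obtain ⟨y, rfl⟩ := exists_projQuotientι_eq (polyGrading k n) (principal hF) x
      ((Ideal.span_singleton_le_iff_mem _).2 ((localEquation_mem_maximalIdeal hF i x hx).1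
        (Ideal.pow_le_self two_ne_zero h)))
    refine ⟨y, fun hy ↦ ?_, rfl⟩
    exact not_isRegularLocalRing_quotient (localEquation_ne_zero hF i hF0 _ hx) h
      ((isRegularLocalRing_stalk_hypersurface_iff hF i y hx).1 hy)

/-- The equation `F / x_i ^ l` of `V(F)` on the chart `D₊(x_i)`. -/
noncomputable def chartEquation : Γ(ProjSpace k n, chart k n i) :=
  Proj.awayToSection (polyGrading k n) (MvPolynomial.X i) (Away.mk _ (X_mem_polyGrading k n i) l F
    (by simpa using hF))

theorem evalHom_chartEquation (x : (chart k n i : (ProjSpace k n).Opens)) :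
    evalHom _ _ x (chartEquation hF i) = localEquation hF i (x : ProjSpace k n) x.2 := by
  apply HomogeneousLocalization.val_injective
  simp only [chartEquation, localEquation]
  rfl

end Hypersurface

/-! ### Sections of `𝒥(l)` and singular points -/

section ConormalKernel

open HomogeneousLocalization IsLocalRing

variable {k : Type u} [Field k] {n : ℕ} {C : Scheme.{u}} (i : C ⟶ ProjSpace k n)
  [IsClosedImmersion i]

theorem mem_range_iff_evalHom {U : (ProjSpace k n).affineOpens} (x : (U : (ProjSpace k n).Opens)) :
    (x : ProjSpace k n) ∈ Set.range i ↔
      ∀ s ∈ i.ker.ideal U, evalHom (polyGrading k n) U x s ∈ maximalIdeal _ := by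
  rw [← mem_zeroLocus_iff_evalHom, ← Scheme.IdealSheafData.mem_support_iff_of_mem x.2,
    ← SetLike.mem_coe, Scheme.Hom.support_ker, i.isClosedEmbedding.isClosed_range.closure_eq]

theorem isRadical_ker_ideal [IsReduced C] (U : (ProjSpace k n).affineOpens) :
    (i.ker.ideal U).IsRadical := by
  rw [Scheme.Hom.ker_apply]
  rintro s ⟨m, hs⟩
  rw [RingHom.mem_ker, map_pow] at hs
  exact IsReduced.eq_zero _ ⟨m, hs⟩

/-- Sections of `𝒥` lie in the square of the maximal ideal at every point of `C`. -/
theorem evalHom_mem_sq [PerfectField k] {U : (ProjSpace k n).affineOpens}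
    (x : (U : (ProjSpace k n).Opens)) (hx : (x : ProjSpace k n) ∈ Set.range i)
    {s : Γ(ProjSpace k n, U)} (hs : s ∈ (idealSheafJ i).ideal U) :
    evalHom (polyGrading k n) U x s ∈ maximalIdeal _ ^ 2 := by
  let _ : Algebra k Γ(ProjSpace k n, U) := (structureRingHom (projStructure k n) U).toAlgebra
  let _ : Algebra k (LocalRing (polyGrading k n) (x : ProjSpace k n)) := (scalarHom k n _).toAlgebra
  have := formallySmooth_residueField k n (x : ProjSpace k n)
  have hs' : s ∈ conormalKernel k (i.ker.ideal U) := hs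
  rw [mem_conormalKernel] at hs'
  let φ : Γ(ProjSpace k n, U) →ₐ[k] LocalRing (polyGrading k n) (x : ProjSpace k n) :=
    { evalHom (polyGrading k n) U x with
      commutes' := fun c ↦ structureRingHom_apply k n U c x }
  exact mem_maximalIdeal_sq φ
    (Ideal.map_le_iff_le_comap.2 ((mem_range_iff_evalHom i x).1 hx)) hs'.1 hs'.2

/-- After division by `x_j ^ l`, sections of `𝒥(l)` lie in the square of the maximal ideal at every
point of `C`. -/
theorem exists_of_mem_idealMulTwist [PerfectField k] {U : (ProjSpace k n).affineOpens} {l : ℕ}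
    {t : Values (polyGrading k n) (U : (ProjSpace k n).Opens)}
    (ht : t ∈ idealMulTwist (idealSheafJ i) l U)
    (x : (U : (ProjSpace k n).Opens)) (hx : (x : ProjSpace k n) ∈ Set.range i)
    (j : Fin (n + 1)) (hj : (x : ProjSpace k n) ∈ (chart k n j : (ProjSpace k n).Opens)) :
    ∃ g ∈ maximalIdeal (LocalRing (polyGrading k n) (x : ProjSpace k n)) ^ 2,
      t x = g.val * algebraMap (MvPolynomial (Fin (n + 1)) k) _ (MvPolynomial.X j ^ l) := by
  induction ht using AddSubgroup.closure_induction with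
  | mem t ht =>
    obtain ⟨s, hs, r, hr, rfl⟩ := ht
    obtain ⟨V, hV, d, e, a, b, hde, h⟩ := hr x
    obtain ⟨hb, hab⟩ := h x hV
    have hd : d = e + l := by omega
    subst hd
    -- the quotient of `a / b` by `x_j ^ l`, a fraction of degree zero
    let c : LocalRing (polyGrading k n) (x : ProjSpace k n) :=
      .mk ⟨e + l, a, ⟨(b : MvPolynomial (Fin (n + 1)) k) * MvPolynomial.X j ^ l,
        SetLike.mul_mem_graded b.2 (X_pow_mem_polyGrading j l)⟩,
        (pointIdeal (polyGrading k n) (x : ProjSpace k n)).primeCompl.mul_mem hb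
        ((pointIdeal (polyGrading k n) (x : ProjSpace k n)).primeCompl.pow_mem hj l)⟩
    refine ⟨evalHom (polyGrading k n) U x s * c,
      Ideal.mul_mem_right _ _ (evalHom_mem_sq i x hx hs), ?_⟩
    rw [HomogeneousLocalization.val_mul, mul_assoc, Pi.mul_apply]
    congr 1
    rw [hab, HomogeneousLocalization.val_mk, ← Localization.mk_one_eq_algebraMap,
      Localization.mk_mul, Localization.mk_eq_mk_iff, Localization.r_iff_exists]
    refine ⟨1, ?_⟩
    simp
    ring
  | zero => exact ⟨0, zero_mem _, by rw [HomogeneousLocalization.val_zero, zero_mul]; rfl⟩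
  | add t t' _ _ h h' =>
    obtain ⟨g, hg, e⟩ := h
    obtain ⟨g', hg', e'⟩ := h'
    exact ⟨g + g', add_mem hg hg', by
      rw [HomogeneousLocalization.val_add, add_mul, ← e, ← e']; rfl⟩
  | neg t _ h =>
    obtain ⟨g, hg, e⟩ := h
    exact ⟨-g, neg_mem hg, by rw [HomogeneousLocalization.val_neg, neg_mul, ← e]; rfl⟩

/-- It suffices to look at closed points here, by the affine statement on the chart. -/
theorem chartEquation_mem [IsAlgClosed k] [IsReduced C] {l : ℕ} {F : MvPolynomial (Fin (n + 1)) k}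
    (hF : F ∈ polyGrading k n l) (hF0 : F ≠ 0)
    (h : Set.range i ⊆ hypersurfaceι hF '' singularLocus (hypersurface hF)) (j : Fin (n + 1)) :
    chartEquation hF j ∈ (idealSheafJ i).ideal (chart k n j) := by
  let _ : Algebra k Γ(ProjSpace k n, chart k n j) :=
    (structureRingHom (projStructure k n) (chart k n j)).toAlgebra
  have : Algebra.FiniteType k Γ(ProjSpace k n, chart k n j) :=
    .equiv inferInstance (chartAlgEquiv k n j)
  have : Algebra.FormallySmooth k Γ(ProjSpace k n, chart k n j) :=
    .of_equiv (chartAlgEquiv k n j)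
  change chartEquation hF j ∈ conormalKernel k (i.ker.ideal (chart k n j))
  rw [mem_conormalKernel, mem_and_D_mem_iff_forall_mem_sq (isRadical_ker_ideal i _)]
  intro m hm hIm
  -- the point of the chart with ideal `m`
  let x : (chart k n j : (ProjSpace k n).Opens) := (chart k n j).2.isoSpec.inv ⟨m, hm.isPrime⟩
  have hxm : (chart k n j).2.primeIdealOf x = ⟨m, hm.isPrime⟩ := by
    change ((chart k n j).2.isoSpec.inv ≫ (chart k n j).2.isoSpec.hom) _ = _
    rw [Iso.inv_hom_id]
    rfl
  let _ := (evalHom (polyGrading k n) _ x).toAlgebra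
  have hloc := isLocalization_evalHom (polyGrading k n) (chart k n j).2 x
  simp only [hxm] at hloc
  refine mem_sq_of_map_mem_maximalIdeal_sq
    (L := LocalRing (polyGrading k n) (x : ProjSpace k n)) m ?_
  have hx : (x : ProjSpace k n) ∈ Set.range i := by
    rw [mem_range_iff_evalHom]
    intro s hs
    exact (IsLocalization.AtPrime.to_map_mem_maximal_iff _ m s).2 (hIm hs)
  have hmem := (mem_singularLocus_image_iff hF j hF0 _ x.2).1 (h hx)
  rw [← evalHom_chartEquation] at hmem
  exact hmem

theorem range_subset_iff_mem_gammaTilde [IsAlgClosed k] [IsReduced C] {l : ℕ}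
    {F : MvPolynomial (Fin (n + 1)) k} (hF : F ∈ polyGrading k n l) (hF0 : F ≠ 0) :
    Set.range i ⊆ hypersurfaceι hF '' singularLocus (hypersurface hF) ↔
      ofElement F ⊤ ∈ gammaTilde (idealSheafJ i) l := by
  constructor
  · refine fun h ↦ ⟨ofElement_mem_twistSections hF ⊤, fun x ↦ ?_⟩
    obtain ⟨j, hj⟩ := exists_mem_chart k n x
    refine ⟨chart k n j, le_top, hj, AddSubgroup.subset_closure
      ⟨chartEquation hF j, chartEquation_mem i hF hF0 h j, ofElement (MvPolynomial.X j ^ l) _,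
        ofElement_mem_twistSections (X_pow_mem_polyGrading j l) _, ?_⟩⟩
    funext y
    refine (val_localEquation hF j (y : ProjSpace k n) y.2).symm.trans ?_
    rw [← evalHom_chartEquation]
    rfl
  · rintro ⟨-, h⟩ x hx
    obtain ⟨U, hUtop, hxU, HU⟩ := h ⟨x, trivial⟩
    obtain ⟨j, hj⟩ := exists_mem_chart k n x
    obtain ⟨g, hg, e⟩ := exists_of_mem_idealMulTwist i HU ⟨x, hxU⟩ hx j hj
    rw [mem_singularLocus_image_iff hF j hF0 x hj]
    convert hg
    apply HomogeneousLocalization.val_injective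
    have hu : IsUnit (algebraMap (MvPolynomial (Fin (n + 1)) k)
        (Localization.AtPrime (pointIdeal (polyGrading k n) x)) (MvPolynomial.X j ^ l)) :=
      IsLocalization.map_units _ (⟨_, (pointIdeal (polyGrading k n) x).primeCompl.pow_mem hj l⟩ :
        (pointIdeal (polyGrading k n) x).primeCompl)
    exact hu.mul_left_injective ((val_localEquation hF j x hj).trans e)

end ConormalKernel

end SingularAlong

theorem mainTheorem4 {k : Type u} [Field k] [IsAlgClosed k] (n : ℕ) :
    (∀ (C : Scheme.{u}) [IsReduced C] (i : C ⟶ ProjSpace k n) [IsClosedImmersion i]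
      (l : ℕ) (F : MvPolynomial (Fin (n + 1)) k) (hF : F ∈ polyGrading k n l), F ≠ 0 →
      (Set.range i ⊆ hypersurfaceι hF '' singularLocus (hypersurface hF) ↔
        ofElement F ⊤ ∈ gammaTilde (idealSheafJ i) l)) ∧
    (∀ I : Ideal (MvPolynomial (Fin n) k), I.IsRadical → ∀ f : MvPolynomial (Fin n) k,
      (f ∈ I ∧ KaehlerDifferential.D k (MvPolynomial (Fin n) k) f ∈
          I • (⊤ : Submodule (MvPolynomial (Fin n) k) (Ω[MvPolynomial (Fin n) k⁄k]))) ↔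
        ∀ m : Ideal (MvPolynomial (Fin n) k), m.IsMaximal → I ≤ m → f ∈ m ^ 2) :=
  ⟨fun _ _ i _ _ _ hF hF0 ↦ range_subset_iff_mem_gammaTilde i hF hF0,
    fun _ hI f ↦ mem_and_D_mem_iff_forall_mem_sq hI f⟩
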